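/- Let $k\ge 1$ be an integer and let $X$ be a real random variable with $\mathbb E|X|^{2k}<\infty$. Put $\mu=\mathbb E X$, $\sigma^2=\operatorname{Var}(X)$ and $\mu_j=\mathbb E(X-\mu)^j$ for $0\le j\le 2k$. Let $X_1,X_2,\dots$ be independent copies of $X$, and for $n\ge 1$ let $$\bar X_n=\frac1n\sum_{i=1}^n X_i,\qquad M_{j,n}=\frac1n\sum_{i=1}^n (X_i-\bar X_n)^j\quad(2\le j\le k).$$ Let $V_k=(v_{ij})\in\mathbb R^{k\times k}$ be the matrix with entries $$v_{11}=\sigma^2,\qquad v_{1j}=v_{j1}=\mu_{j+1}-j\sigma^2\mu_{j-1}\quad(2\le j\le k),$$ $$v_{ij}=\mu_{i+j}-\mu_i\mu_j-i\mu_{i-1}\mu_{j+1}-j\mu_{i+1}\mu_{j-1}+ij\sigma^2\mu_{i-1}\mu_{j-1}\quad(2\le i,j\le k).$$ Then $V_k$ is positive semidefinite and, as $n\to\infty$, $$\sqrt n\,\bigl((\bar X_n-\mu,M_{2,n},\dots,M_{k,n})'-(0,\sigma^2,\mu_3,\dots,\mu_k)'\bigr)\ \xrightarrow{\ \mathrm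 d\ }\ N_k(\mathbf 0,V_k),$$ where $N_k(\mathbf 0,V_k)$ is the (possibly degenerate) centred $k$-dimensional normal distribution with covariance matrix $V_k$. (For $k=1$ the vectors consist of the first entry only.) -/

import Mathlib

open MeasureTheory ProbabilityTheory Filter

namespace SampleMoments

variable {Ω Ω₀ : Type*} [MeasurableSpace Ω₀]

/-- The sample mean `(1/n) ∑ X_i` of the first `n` observations `S 0, …, S (n-1)`. -/
noncomputable def sampleMean (S : ℕ → Ω → ℝ) (n : ℕ) (ω : Ω) : ℝ :=
  (1 / (n : ℝ)) * ∑ i ∈ Finset.range n, S i ω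

/-- The sample central moment of order `j`, `M_{j,n} = (1/n) ∑ (X_i - mean)^j`. -/
noncomputable def sampleCentralMoment (S : ℕ → Ω → ℝ) (j n : ℕ) (ω : Ω) : ℝ :=
  (1 / (n : ℝ)) * ∑ i ∈ Finset.range n, (S i ω - sampleMean S n ω) ^ j

/-- The random vector `(mean - m, M_{2,n}, …, M_{k,n})` in Euclidean space `ℝ^k`; the coordinate
with index `j : Fin k` is the one of order `j + 1`. -/
noncomputable def sampleVector (S : ℕ → Ω → ℝ) (m : ℝ) (k n : ℕ) (ω : Ω) :
    EuclideanSpace ℝ (Fin k) :=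
  WithLp.toLp 2 fun j =>
    if (j : ℕ) = 0 then sampleMean S n ω - m else sampleCentralMoment S ((j : ℕ) + 1) n ω

/-- The vector `(0, μ_2, …, μ_k)`, where `μ_j = E (X - E X)^j`. -/
noncomputable def centralMomentVector (X : Ω₀ → ℝ) (P₀ : Measure Ω₀) (k : ℕ) :
    EuclideanSpace ℝ (Fin k) :=
  WithLp.toLp 2 fun j => if (j : ℕ) = 0 then 0 else centralMoment X ((j : ℕ) + 1) P₀

/-- The number `v_{ij}`, for orders `i, j ≥ 1`. -/
noncomputable def asympCov (X : Ω₀ → ℝ) (P₀ : Measure Ω₀) (i j : ℕ) : ℝ :=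
  let μ : ℕ → ℝ := fun r => centralMoment X r P₀
  let σsq : ℝ := variance X P₀
  if i = 1 ∧ j = 1 then σsq
  else if i = 1 then μ (j + 1) - j * σsq * μ (j - 1)
  else if j = 1 then μ (i + 1) - i * σsq * μ (i - 1)
  else μ (i + j) - μ i * μ j - i * μ (i - 1) * μ (j + 1) - j * μ (i + 1) * μ (j - 1)
    + i * j * σsq * μ (i - 1) * μ (j - 1)

/-- The `k × k` matrix `V_k = (v_{ij})`, `1 ≤ i, j ≤ k`; row and column indices are shifted by one. -/
noncomputable def asympCovMatrix (X : Ω₀ → ℝ) (P₀ : Measure Ω₀) (k : ℕ) :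
    Matrix (Fin k) (Fin k) ℝ :=
  Matrix.of fun i j => asympCov X P₀ ((i : ℕ) + 1) ((j : ℕ) + 1)

end SampleMoments

/-! ### Gram matrices of square-integrable functions -/

section Gram

variable {Ω : Type*} [MeasurableSpace Ω] {P : Measure Ω} {ι : Type*} [Fintype ι]
  {f : ι → Ω → ℝ}

/-! This is the delta method made explicit. Write `Y = X - μ` and `z` for the mean of the `Y_i`.
Expanding `(Y_i - z)^j` shows that `√n (M_j - μ_j)` is the normalized sum of `L_j(Y_i) = Y_i^j - μ_j
- j μ_{j-1} Y_i` plus `√n z` times a factor (`sqrt_smul_sampleVector_sub_apply`). By the strong law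
the factor tends to `0` almost surely (`ae_tendsto_errorFactor`). With `L_1(Y) = Y`, the `L_j(Y)`
are centred and `V_k` is their Gram matrix (`asympCovMatrix_eq`). This gives positive
semidefiniteness and, through the multivariate central limit theorem, the limit of the main term.
Slutsky's theorem removes the error. -/

lemma integral_sq_sum_mul_eq_dotProduct (hf : ∀ i, MemLp (f i) 2 P) (x : ι → ℝ) :
    ∫ ω, (∑ i, x i * f i ω) ^ 2 ∂P =
      x ⬝ᵥ (Matrix.of fun i j => ∫ ω, f i ω * f j ω ∂P).mulVec x := by
  have hint : ∀ i j, Integrable (fun ω => x i * f i ω * (x j * f j ω)) P := fun i j =>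
    ((hf i).const_mul (x i)).integrable_mul ((hf j).const_mul (x j))
  simp_rw [sq, Finset.sum_mul_sum]
  rw [integral_finsetSum _ fun i _ => integrable_finsetSum _ fun j _ => hint i j]
  simp only [dotProduct, Matrix.mulVec, Matrix.of_apply, Finset.mul_sum]
  refine Finset.sum_congr rfl fun i _ => ?_
  rw [integral_finsetSum _ fun j _ => hint i j]
  refine Finset.sum_congr rfl fun j _ => ?_
  rw [← integral_mul_const, ← integral_const_mul]
  exact integral_congr_ae (.of_forall fun ω => by ring)

lemma posSemidef_of_integral_mul (hf : ∀ i, MemLp (f i) 2 P) :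
    (Matrix.of fun i j => ∫ ω, f i ω * f j ω ∂P).PosSemidef := by
  refine Matrix.PosSemidef.of_dotProduct_mulVec_nonneg ?_ fun x => ?_
  · ext i j
    simp [mul_comm]
  · rw [star_trivial, ← integral_sq_sum_mul_eq_dotProduct hf]
    exact integral_nonneg fun ω => sq_nonneg _

end Gram

/-- The multivariate central limit theorem for centred vectors. -/
theorem tendstoInDistribution_inv_sqrt_smul_sum_multivariateGaussian
    {Ω ι : Type*} [MeasurableSpace Ω] [Fintype ι] [DecidableEq ι] {P : Measure Ω}
    [IsProbabilityMeasure P] {ξ : ℕ → Ω → EuclideanSpace ℝ ι}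
    (hindep : iIndepFun ξ P) (hident : ∀ n, IdentDistrib (ξ n) (ξ 0) P P)
    (hL2 : ∀ i, MemLp (fun ω => ξ 0 ω i) 2 P) (hmean : ∀ i, ∫ ω, ξ 0 ω i ∂P = 0) :
    TendstoInDistribution (fun (n : ℕ) ω => (√(n : ℝ))⁻¹ • ∑ m ∈ Finset.range n, ξ m ω) atTop
      (id : EuclideanSpace ℝ ι → EuclideanSpace ℝ ι) (fun _ => P)
      (multivariateGaussian 0 (Matrix.of fun i j => ∫ ω, ξ 0 ω i * ξ 0 ω j ∂P)) := by
  have hmeas n : AEMeasurable (ξ n) P := (hident n).aemeasurable_fst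
  have hsum (n : ℕ) : AEMeasurable
      (fun ω => (√(n : ℝ))⁻¹ • ∑ m ∈ Finset.range n, ξ m ω) P :=
    (Finset.aemeasurable_fun_sum _ fun m _ => hmeas m).const_smul (√(n : ℝ))⁻¹
  refine ⟨hsum, by fun_prop, ?_⟩
  -- Cramér–Wold: the characteristic function at `t` is that of the projection onto `t` at `1`, so
  -- the real central limit theorem suffices.
  refine ProbabilityMeasure.tendsto_iff_tendsto_charFun.2 fun t => ?_
  have hV := posSemidef_of_integral_mul hL2
  have hinner (y : EuclideanSpace ℝ ι) : inner ℝ y t = ∑ i, t i * y i := by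
    simp [PiLp.inner_apply]
  have hc : Measurable fun y : EuclideanSpace ℝ ι => inner ℝ y t := by fun_prop
  have hη2 : MemLp (fun ω => inner ℝ (ξ 0 ω) t) 2 P := by
    simp_rw [hinner]
    exact memLp_finsetSum _ fun i _ => (hL2 i).const_mul _
  have hη0 : ∫ ω, inner ℝ (ξ 0 ω) t ∂P = 0 := by
    simp_rw [hinner]
    rw [integral_finsetSum _ fun i _ => ((hL2 i).const_mul _).integrable (by norm_num)]
    simp [integral_const_mul, hmean]
  have hvar : Var[fun ω => inner ℝ (ξ 0 ω) t; P] =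
      t.ofLp ⬝ᵥ (Matrix.of fun i j => ∫ ω, ξ 0 ω i * ξ 0 ω j ∂P).mulVec t.ofLp := by
    rw [variance_of_integral_eq_zero hη2.aemeasurable hη0,
      ← integral_sq_sum_mul_eq_dotProduct hL2]
    simp_rw [hinner]
  have hnn := hvar ▸ variance_nonneg (fun ω => inner ℝ (ξ 0 ω) t) P
  have key := tendstoInDistribution_inv_sqrt_mul_sum_sub
    (X := fun n ω => inner ℝ (ξ n ω) t) (P := P) (Y := id)
    (P' := gaussianReal 0 Var[fun ω => inner ℝ (ξ 0 ω) t; P].toNNReal)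
    .id hη2 (hindep.comp (fun _ y => inner ℝ y t) fun _ => hc) fun n => (hident n).comp hc
  have := ProbabilityMeasure.tendsto_iff_tendsto_charFun.1 key.tendsto 1
  simp only [ProbabilityMeasure.coe_mk, Measure.map_id, charFun_gaussianReal, hvar,
    Real.coe_toNNReal _ hnn] at this
  simp only [ProbabilityMeasure.coe_mk, Measure.map_id, charFun_multivariateGaussian hV]
  convert! this using 1
  · ext n
    rw [charFun_apply, charFun_apply,
      integral_map (hsum n) (by fun_prop),
      integral_map (key.forall_aemeasurable n) (by fun_prop)]
    simp [hη0, sum_inner, real_inner_smul_left]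
  · simp

/-! ### Linearization of the sample moments -/

namespace SampleMoments

/-- The summand of order `j` in the linearization of the sample moments, as a function of the
centred observation `x`, for a distribution with central moments `μ`. -/
noncomputable def linearTerm (μ : ℕ → ℝ) (j : ℕ) (x : ℝ) : ℝ :=
  if j = 1 then x else x ^ j - μ j - j * μ (j - 1) * x

/-- The average of the `r`-th powers of the observations after subtraction of `m`. -/
noncomputable def powerMean (S : ℕ → Ω → ℝ) (m : ℝ) (r n : ℕ) (ω : Ω) : ℝ :=
  (1 / (n : ℝ)) * ∑ i ∈ Finset.range n, (S i ω - m) ^ r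

/-- The factor by which `√n (mean - m)` has to be multiplied to give the linearization error of
the sample central moment of order `j`. -/
noncomputable def errorFactor (S : ℕ → Ω → ℝ) (m : ℝ) (μ : ℕ → ℝ) (j n : ℕ) (ω : Ω) : ℝ :=
  if j = 1 then 0 else
    powerMean S m 1 n ω * ∑ l ∈ Finset.range (j - 1), ((j.choose (l + 2) : ℕ) : ℝ) *
      (-1) ^ l * powerMean S m 1 n ω ^ l * powerMean S m (j - 2 - l) n ω
    - j * (powerMean S m (j - 1) n ω - μ (j - 1))

lemma measurable_linearTerm (μ : ℕ → ℝ) (j : ℕ) : Measurable (linearTerm μ j) := by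
  unfold linearTerm
  split_ifs <;> fun_prop

lemma sampleMean_eq_powerMean_add (S : ℕ → Ω → ℝ) (m : ℝ) {n : ℕ} (hn : n ≠ 0) (ω : Ω) :
    sampleMean S n ω = powerMean S m 1 n ω + m := by
  simp only [sampleMean, powerMean, pow_one, Finset.sum_sub_distrib, Finset.sum_const,
    Finset.card_range, nsmul_eq_mul]
  field_simp
  ring

/-- Binomial theorem with the terms of degree at least two in `z` collected behind `z ^ 2`: one
factor `z` absorbs `√n`, the other tends to `0`. -/
lemma sub_pow_add_two (x z : ℝ) (p : ℕ) :
    (x - z) ^ (p + 2) = x ^ (p + 2) - (p + 2 : ℕ) * z * x ^ (p + 1) +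
      z ^ 2 * ∑ l ∈ Finset.range (p + 1), (((p + 2).choose (l + 2) : ℕ) : ℝ) *
        (-1) ^ l * z ^ l * x ^ (p - l) := by
  rw [sub_eq_neg_add, add_pow, Finset.sum_range_succ', Finset.sum_range_succ', Finset.mul_sum]
  have h : ∀ l ∈ Finset.range (p + 1),
      (-z) ^ (l + 1 + 1) * x ^ (p + 2 - (l + 1 + 1)) * (((p + 2).choose (l + 1 + 1) : ℕ) : ℝ) =
      z ^ 2 * ((((p + 2).choose (l + 2) : ℕ) : ℝ) * (-1) ^ l * z ^ l * x ^ (p - l)) := by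
    intro l _
    rw [show p + 2 - (l + 1 + 1) = p - l by omega, neg_pow z]
    ring
  rw [Finset.sum_congr rfl h]
  simp
  ring

lemma sampleCentralMoment_eq (S : ℕ → Ω → ℝ) (m : ℝ) (p : ℕ) {n : ℕ} (hn : n ≠ 0) (ω : Ω) :
    sampleCentralMoment S (p + 2) n ω = powerMean S m (p + 2) n ω
      - (p + 2 : ℕ) * powerMean S m 1 n ω * powerMean S m (p + 1) n ω
      + powerMean S m 1 n ω ^ 2 * ∑ l ∈ Finset.range (p + 1),
        (((p + 2).choose (l + 2) : ℕ) : ℝ) * (-1) ^ l * powerMean S m 1 n ω ^ l *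
          powerMean S m (p - l) n ω := by
  have h (i : ℕ) : (S i ω - sampleMean S n ω) ^ (p + 2) =
      ((S i ω - m) - powerMean S m 1 n ω) ^ (p + 2) := by
    rw [sampleMean_eq_powerMean_add S m hn]; ring
  rw [sampleCentralMoment, Finset.sum_congr rfl fun i _ => (h i).trans (sub_pow_add_two _ _ _)]
  generalize powerMean S m 1 n ω = z
  simp only [powerMean, Finset.sum_add_distrib, Finset.sum_sub_distrib, ← Finset.mul_sum]
  rw [Finset.sum_comm]
  simp only [← Finset.mul_sum]
  have : ∀ l, (((p + 2).choose (l + 2) : ℕ) : ℝ) * (-1) ^ l * z ^ l *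
      (1 / (n : ℝ) * ∑ i ∈ Finset.range n, (S i ω - m) ^ (p - l)) = 1 / (n : ℝ) *
      ((((p + 2).choose (l + 2) : ℕ) : ℝ) * (-1) ^ l * z ^ l *
        ∑ i ∈ Finset.range n, (S i ω - m) ^ (p - l)) := fun l => by ring
  simp_rw [this, ← Finset.mul_sum]
  ring

lemma sqrt_mul_powerMean (S : ℕ → Ω → ℝ) (m : ℝ) (r n : ℕ) (ω : Ω) :
    √(n : ℝ) * powerMean S m r n ω = (√(n : ℝ))⁻¹ * ∑ i ∈ Finset.range n, (S i ω - m) ^ r := by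
  rw [powerMean, ← mul_assoc, mul_one_div, Real.sqrt_div_self]

/-- The scaled sample moments are a normalized sum of independent terms plus an error that is
`√n (mean - m)` times a random factor. -/
lemma sqrt_smul_sampleVector_sub_apply {Ω₀ : Type*} [MeasurableSpace Ω₀] (X : Ω₀ → ℝ)
    (P₀ : Measure Ω₀) (S : ℕ → Ω → ℝ) (m : ℝ) (k n : ℕ) (ω : Ω) (j : Fin k) :
    (√(n : ℝ) • (sampleVector S m k n ω - centralMomentVector X P₀ k)) j =
      (√(n : ℝ))⁻¹ * ∑ i ∈ Finset.range n,
          linearTerm (fun r => centralMoment X r P₀) ((j : ℕ) + 1) (S i ω - m)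
        + ((√(n : ℝ))⁻¹ * ∑ i ∈ Finset.range n, (S i ω - m)) *
          errorFactor S m (fun r => centralMoment X r P₀) ((j : ℕ) + 1) n ω := by
  -- For `n = 0` both sides vanish; `sampleMean_eq_powerMean_add` needs `n ≠ 0`.
  rcases eq_or_ne n 0 with rfl | hn
  · simp
  have h1 := sqrt_mul_powerMean S m 1 n ω
  simp only [pow_one] at h1
  rw [← h1]
  obtain ⟨j, hj⟩ := j
  cases j with
  | zero =>
    simpa [sampleVector, centralMomentVector, linearTerm, errorFactor,
      sampleMean_eq_powerMean_add S m hn] using h1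
  | succ p =>
    have hlin : (√(n : ℝ))⁻¹ * ∑ i ∈ Finset.range n,
          linearTerm (fun r => centralMoment X r P₀) (p + 2) (S i ω - m) =
        √(n : ℝ) * powerMean S m (p + 2) n ω - √(n : ℝ) * centralMoment X (p + 2) P₀
          - (p + 2 : ℕ) * centralMoment X (p + 1) P₀ * (√(n : ℝ) * powerMean S m 1 n ω) := by
      have hs : (√(n : ℝ))⁻¹ * n = √(n : ℝ) := by
        rw [inv_mul_eq_div, Real.div_sqrt]
      rw [h1, sqrt_mul_powerMean]
      simp only [linearTerm, show p + 2 ≠ 1 by omega, if_false, Finset.sum_sub_distrib,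
        ← Finset.mul_sum, Finset.sum_const, Finset.card_range, nsmul_eq_mul]
      rw [mul_sub, mul_sub, ← mul_assoc _ (n : ℝ), hs, show p + 2 - 1 = p + 1 by rfl]
      ring
    simp only [sampleVector, centralMomentVector, PiLp.smul_apply, PiLp.sub_apply, smul_eq_mul,
      Nat.succ_ne_zero, if_false, errorFactor]
    rw [show p + 1 + 1 = p + 2 from rfl, hlin, sampleCentralMoment_eq S m p hn]
    simp only [show p + 2 ≠ 1 by omega, if_false, Nat.add_sub_cancel, show p + 2 - 1 = p + 1 by rfl]
    ring

/-! ### Moments of the linear terms and the covariance matrix -/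

section Limit

variable {Ω₀ : Type*} [MeasurableSpace Ω₀] {P₀ : Measure Ω₀} [IsProbabilityMeasure P₀]
  {X : Ω₀ → ℝ} {k : ℕ}

lemma memLp_sub_integral (hX : AEMeasurable X P₀) (hk : 1 ≤ k)
    (hmom : Integrable (fun ω => |X ω| ^ (2 * k)) P₀) :
    MemLp (fun ω => X ω - ∫ x, X x ∂P₀) (2 * k : ℕ) P₀ := by
  refine MemLp.sub ?_ (memLp_const _)
  rw [← integrable_norm_rpow_iff hX.aestronglyMeasurable (by simp; omega)
    (ENNReal.natCast_ne_top _)]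
  simpa [-Nat.cast_mul, ← Real.rpow_natCast] using hmom

lemma memLp_sub_integral_pow (hX : AEMeasurable X P₀) (hk : 1 ≤ k)
    (hmom : Integrable (fun ω => |X ω| ^ (2 * k)) P₀) {j : ℕ} (hj : j ≤ k) :
    MemLp (fun ω => (X ω - ∫ x, X x ∂P₀) ^ j) 2 P₀ := by
  have h := memLp_sub_integral hX hk hmom
  rw [memLp_two_iff_integrable_sq (by fun_prop)]
  have h2 : MemLp (fun ω => X ω - ∫ x, X x ∂P₀) (2 * j : ℕ) P₀ :=
    h.mono_exponent (by exact_mod_cast Nat.mul_le_mul_left 2 hj)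
  have := h2.integrable_norm_pow'
  refine this.congr (.of_forall fun ω => ?_)
  simp [pow_mul, pow_right_comm]

lemma integrable_sub_integral_pow (hX : AEMeasurable X P₀) (hk : 1 ≤ k)
    (hmom : Integrable (fun ω => |X ω| ^ (2 * k)) P₀) {j : ℕ} (hj : j ≤ 2 * k) :
    Integrable (fun ω => (X ω - ∫ x, X x ∂P₀) ^ j) P₀ := by
  have h := (memLp_sub_integral hX hk hmom).mono_exponent
    (p := (j : ℕ)) (by exact_mod_cast hj)
  rw [← integrable_norm_iff (by fun_prop)]
  simpa using h.integrable_norm_pow'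


lemma integrable_linearTerm_mul_pow (hX : AEMeasurable X P₀) (hk : 1 ≤ k)
    (hmom : Integrable (fun ω => |X ω| ^ (2 * k)) P₀) (μ : ℕ → ℝ) {i r : ℕ} (hi : 1 ≤ i)
    (hir : i + r ≤ 2 * k) :
    Integrable (fun ω => (X ω - ∫ x, X x ∂P₀) ^ r * linearTerm μ i (X ω - ∫ x, X x ∂P₀)) P₀ := by
  have h1 := integrable_sub_integral_pow hX hk hmom hir
  have h2 := integrable_sub_integral_pow hX hk hmom (j := r) (by omega)
  have h3 := integrable_sub_integral_pow hX hk hmom (j := r + 1) (by omega)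
  unfold linearTerm
  split_ifs with h
  · simpa only [pow_succ] using h3
  · refine ((h1.sub (h2.const_mul (μ i))).sub (h3.const_mul (i * μ (i - 1)))).congr
      (.of_forall fun ω => ?_)
    simp only [Pi.sub_apply]
    ring

/-- Integrating a function against `linearTerm`. -/
lemma integral_mul_linearTerm {f Y : Ω₀ → ℝ} (μ : ℕ → ℝ) {j : ℕ} (hj : j ≠ 1)
    (h0 : Integrable f P₀) (h1 : Integrable (fun ω => Y ω * f ω) P₀)
    (h2 : Integrable (fun ω => Y ω ^ j * f ω) P₀) :
    ∫ ω, f ω * linearTerm μ j (Y ω) ∂P₀ = ∫ ω, Y ω ^ j * f ω ∂P₀ - μ j * ∫ ω, f ω ∂P₀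
      - j * μ (j - 1) * ∫ ω, Y ω * f ω ∂P₀ := by
  rw [← integral_const_mul, ← integral_const_mul, ← integral_sub h2 (h0.const_mul _),
    ← integral_sub (f := fun ω => Y ω ^ j * f ω - μ j * f ω) (h2.sub (h0.const_mul _))
      (h1.const_mul _)]
  refine integral_congr_ae (.of_forall fun ω => ?_)
  simp only [linearTerm, if_neg hj]
  ring

lemma integral_pow_mul_linearTerm (hX : AEMeasurable X P₀) (hk : 1 ≤ k)
    (hmom : Integrable (fun ω => |X ω| ^ (2 * k)) P₀) {i r : ℕ} (hi : 2 ≤ i)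
    (hir : i + r ≤ 2 * k) :
    ∫ ω, (X ω - ∫ x, X x ∂P₀) ^ r *
        linearTerm (fun r => centralMoment X r P₀) i (X ω - ∫ x, X x ∂P₀) ∂P₀ =
      centralMoment X (i + r) P₀ - centralMoment X i P₀ * centralMoment X r P₀
        - i * centralMoment X (i - 1) P₀ * centralMoment X (r + 1) P₀ := by
  have h1 := integrable_sub_integral_pow hX hk hmom hir
  have h2 := integrable_sub_integral_pow hX hk hmom (j := r) (by omega)
  have h3 := integrable_sub_integral_pow hX hk hmom (j := r + 1) (by omega)
  rw [integral_mul_linearTerm _ (by omega) h2 (by simpa only [pow_succ'] using h3)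
    (by simpa only [pow_add] using h1)]
  simp only [← pow_succ', ← pow_add]
  rfl

lemma integral_linearTerm (hX : AEMeasurable X P₀) (hk : 1 ≤ k)
    (hmom : Integrable (fun ω => |X ω| ^ (2 * k)) P₀) {i : ℕ} (hi : 1 ≤ i) (hik : i ≤ k) :
    ∫ ω, linearTerm (fun r => centralMoment X r P₀) i (X ω - ∫ x, X x ∂P₀) ∂P₀ = 0 := by
  have hX1 : centralMoment X 1 P₀ = 0 := centralMoment_one
  rcases hi.eq_or_lt with rfl | hi
  · simpa [linearTerm, centralMoment] using hX1
  · have := integral_pow_mul_linearTerm hX hk hmom (r := 0) hi (by omega)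
    simp only [pow_zero, one_mul, add_zero, zero_add, hX1] at this
    rw [this]
    simp [centralMoment]

lemma integral_linearTerm_mul_linearTerm (hX : AEMeasurable X P₀) (hk : 1 ≤ k)
    (hmom : Integrable (fun ω => |X ω| ^ (2 * k)) P₀) {i j : ℕ} (hi : 1 ≤ i) (hik : i ≤ k)
    (hj : 1 ≤ j) (hjk : j ≤ k) :
    ∫ ω, linearTerm (fun r => centralMoment X r P₀) i (X ω - ∫ x, X x ∂P₀) *
        linearTerm (fun r => centralMoment X r P₀) j (X ω - ∫ x, X x ∂P₀) ∂P₀ =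
      asympCov X P₀ i j := by
  have hX1 : centralMoment X 1 P₀ = 0 := centralMoment_one
  have hX2 := centralMoment_two_eq_variance hX
  have hlin1 (x : ℝ) : linearTerm (fun r => centralMoment X r P₀) 1 x = x ^ 1 := by
    simp [linearTerm]
  rcases hi.eq_or_lt with rfl | hi <;> rcases hj.eq_or_lt with rfl | hj
  · simp only [hlin1, ← pow_add, asympCov, and_self, if_true, ← hX2]
    rfl
  · simp only [hlin1]
    rw [integral_pow_mul_linearTerm hX hk hmom hj (by omega)]
    simp [asympCov, hj.ne', hX1, hX2]
    ring
  · simp only [hlin1, mul_comm _ (_ ^ 1)]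
    rw [integral_pow_mul_linearTerm hX hk hmom hi (by omega)]
    simp [asympCov, hi.ne', hX1, hX2]
    ring
  · have h0 := integral_linearTerm hX hk hmom hi.le hik
    have h1 := integral_pow_mul_linearTerm hX hk hmom (r := 1) hi (by omega)
    have h2 := integral_pow_mul_linearTerm hX hk hmom (r := j) hi (by omega)
    have i0 := integrable_linearTerm_mul_pow hX hk hmom (fun r => centralMoment X r P₀) (r := 0)
      hi.le (by omega)
    have i1 := integrable_linearTerm_mul_pow hX hk hmom (fun r => centralMoment X r P₀) (r := 1)
      hi.le (by omega)
    have i2 := integrable_linearTerm_mul_pow hX hk hmom (fun r => centralMoment X r P₀) (r := j)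
      hi.le (by omega)
    simp only [pow_zero, one_mul] at i0
    simp only [pow_one] at i1 h1
    -- Only the factor of order `j` is expanded; the other is integrated against the powers `0`, `1`
    -- and `j`.
    rw [integral_mul_linearTerm _ hj.ne' i0 i1 i2, h0, h1, h2]
    simp [asympCov, hi.ne', hj.ne', hX1, hX2]
    ring

lemma memLp_linearTerm (hX : AEMeasurable X P₀) (hk : 1 ≤ k)
    (hmom : Integrable (fun ω => |X ω| ^ (2 * k)) P₀) (μ : ℕ → ℝ) {i : ℕ} (hik : i ≤ k) :
    MemLp (fun ω => linearTerm μ i (X ω - ∫ x, X x ∂P₀)) 2 P₀ := by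
  have h1 := memLp_sub_integral_pow hX hk hmom hk
  simp only [pow_one] at h1
  unfold linearTerm
  split_ifs with h
  · exact h1
  · exact ((memLp_sub_integral_pow hX hk hmom hik).sub (memLp_const _)).sub (h1.const_mul _)

lemma asympCovMatrix_eq (hX : AEMeasurable X P₀) (hk : 1 ≤ k)
    (hmom : Integrable (fun ω => |X ω| ^ (2 * k)) P₀) :
    asympCovMatrix X P₀ k = Matrix.of fun i j : Fin k =>
      ∫ ω, linearTerm (fun r => centralMoment X r P₀) ((i : ℕ) + 1) (X ω - ∫ x, X x ∂P₀) *
        linearTerm (fun r => centralMoment X r P₀) ((j : ℕ) + 1) (X ω - ∫ x, X x ∂P₀) ∂P₀ := by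
  ext i j
  simp only [asympCovMatrix, Matrix.of_apply]
  rw [integral_linearTerm_mul_linearTerm hX hk hmom (by omega) (by omega) (by omega) (by omega)]

/-! ### Law of large numbers for the error factor -/

variable [MeasurableSpace Ω] {P : Measure Ω} {S : ℕ → Ω → ℝ}

lemma aemeasurable_powerMean (hS : ∀ i, AEMeasurable (S i) P) (m : ℝ) (r n : ℕ) :
    AEMeasurable (powerMean S m r n) P := by
  unfold powerMean
  exact (Finset.aemeasurable_fun_sum _ fun i _ => ((hS i).sub_const m).pow_const r).const_mul _

lemma aemeasurable_errorFactor (hS : ∀ i, AEMeasurable (S i) P) (m : ℝ) (μ : ℕ → ℝ) (j n : ℕ) :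
    AEMeasurable (errorFactor S m μ j n) P := by
  have h r := aemeasurable_powerMean hS m r n
  unfold errorFactor
  split_ifs
  · exact aemeasurable_const
  · refine ((h 1).mul (Finset.aemeasurable_fun_sum _ fun l _ => ?_)).sub
      (((h _).sub_const _).const_mul _)
    exact (((h 1).pow_const l).const_mul _).mul (h _)

lemma ae_tendsto_powerMean (hX : AEMeasurable X P₀) (hk : 1 ≤ k)
    (hmom : Integrable (fun ω => |X ω| ^ (2 * k)) P₀) (hindep : iIndepFun S P)
    (hident : ∀ i, IdentDistrib (S i) X P P₀) {r : ℕ} (hr : r ≤ k) :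
    ∀ᵐ ω ∂P, Tendsto (fun n => powerMean S (∫ x, X x ∂P₀) r n ω) atTop
      (nhds (centralMoment X r P₀)) := by
  have hu : Measurable fun x : ℝ => (x - ∫ x, X x ∂P₀) ^ r := by fun_prop
  have hid i := (hident i).comp hu
  have := strong_law_ae_real (fun n ω => (S n ω - ∫ x, X x ∂P₀) ^ r)
    ((hid 0).integrable_iff.2 (integrable_sub_integral_pow hX hk hmom (by omega)))
    (fun i j hij => (hindep.indepFun hij).comp hu hu) fun i => (hid i).trans (hid 0).symm
  filter_upwards [this] with ω hω
  have hlim : ∫ ω, (S 0 ω - ∫ x, X x ∂P₀) ^ r ∂P = centralMoment X r P₀ := (hid 0).integral_eq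
  rw [hlim] at hω
  simpa only [powerMean, div_eq_inv_mul, mul_one] using hω

lemma ae_tendsto_errorFactor (hX : AEMeasurable X P₀) (hk : 1 ≤ k)
    (hmom : Integrable (fun ω => |X ω| ^ (2 * k)) P₀) (hindep : iIndepFun S P)
    (hident : ∀ i, IdentDistrib (S i) X P P₀) {j : ℕ} (hj : 1 ≤ j) (hjk : j ≤ k) :
    ∀ᵐ ω ∂P, Tendsto
      (fun n => errorFactor S (∫ x, X x ∂P₀) (fun r => centralMoment X r P₀) j n ω) atTop
      (nhds 0) := by
  have h : ∀ᵐ ω ∂P, ∀ r ≤ k, Tendsto (fun n => powerMean S (∫ x, X x ∂P₀) r n ω) atTop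
      (nhds (centralMoment X r P₀)) := by
    simp only [ae_all_iff]
    exact fun r hr => ae_tendsto_powerMean hX hk hmom hindep hident hr
  filter_upwards [h] with ω hω
  unfold errorFactor
  split_ifs
  · exact tendsto_const_nhds
  -- The mean of the centred observations tends to `0` and multiplies a convergent sum, whose limit
  -- is therefore irrelevant.
  have h1 := hω 1 hk
  rw [centralMoment_one] at h1
  have hsum := tendsto_finsetSum (Finset.range (j - 1)) fun l _ =>
    ((h1.pow l).const_mul (((j.choose (l + 2) : ℕ) : ℝ) * (-1) ^ l)).mul
      (hω (j - 2 - l) (by omega))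
  simpa using (h1.mul hsum).sub
    (((hω (j - 1) (by omega)).sub_const (centralMoment X (j - 1) P₀)).const_mul (j : ℝ))

end Limit

end SampleMoments

/-! ### Conclusion by Slutsky's theorem -/

theorem mainTheorem8
    {Ω₀ : Type*} [MeasurableSpace Ω₀] (P₀ : Measure Ω₀) [IsProbabilityMeasure P₀]
    {Ω : Type*} [MeasurableSpace Ω] (P : Measure Ω) [IsProbabilityMeasure P]
    (k : ℕ) (hk : 1 ≤ k)
    (X : Ω₀ → ℝ) (hmom : Integrable (fun ω => |X ω| ^ (2 * k)) P₀)
    (S : ℕ → Ω → ℝ) (hindep : iIndepFun S P) (hident : ∀ i, IdentDistrib (S i) X P P₀) :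
    (SampleMoments.asympCovMatrix X P₀ k).PosSemidef ∧
      TendstoInDistribution
        (fun (n : ℕ) (ω : Ω) => Real.sqrt n •
          (SampleMoments.sampleVector S (∫ x, X x ∂P₀) k n ω
            - SampleMoments.centralMomentVector X P₀ k))
        atTop
        (id : EuclideanSpace ℝ (Fin k) → EuclideanSpace ℝ (Fin k))
        (fun _ => P)
        (multivariateGaussian 0 (SampleMoments.asympCovMatrix X P₀ k)) := by
  have hX : AEMeasurable X P₀ := (hident 0).aemeasurable_snd
  have hS i : AEMeasurable (S i) P := (hident i).aemeasurable_fst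
  set m := ∫ x, X x ∂P₀ with hm
  set μ : ℕ → ℝ := fun r => centralMoment X r P₀ with hμ
  have hV := SampleMoments.asympCovMatrix_eq hX hk hmom
  have hL2 (i : Fin k) := SampleMoments.memLp_linearTerm hX hk hmom μ
    (i := (i : ℕ) + 1) (by omega)
  refine ⟨hV ▸ posSemidef_of_integral_mul hL2, ?_⟩
  let u : ℝ → EuclideanSpace ℝ (Fin k) := fun x =>
    WithLp.toLp 2 fun j => SampleMoments.linearTerm μ ((j : ℕ) + 1) (x - m)
  have hcoord (i : Fin k) :
      Measurable fun x => SampleMoments.linearTerm μ ((i : ℕ) + 1) (x - m) :=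
    (SampleMoments.measurable_linearTerm μ _).comp (measurable_id.sub_const m)
  have hu : Measurable u := (WithLp.measurable_toLp 2 _).comp (measurable_pi_lambda _ hcoord)
  have hmul (i j : Fin k) := (hident 0).comp ((hcoord i).mul (hcoord j))
  have hclt := tendstoInDistribution_inv_sqrt_smul_sum_multivariateGaussian
    (ξ := fun n ω => u (S n ω)) (P := P) (hindep.comp (fun _ => u) fun _ => hu)
    (fun n => ((hident n).comp hu).trans ((hident 0).comp hu).symm)
    (fun i => ((hident 0).comp (hcoord i)).memLp_iff.2 (hL2 i))
    (fun i => ((hident 0).comp (hcoord i)).integral_eq.trans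
      (SampleMoments.integral_linearTerm hX hk hmom (by omega) (by omega)))
  have hcov : (Matrix.of fun i j : Fin k => ∫ ω, u (S 0 ω) i * u (S 0 ω) j ∂P) =
      SampleMoments.asympCovMatrix X P₀ k := by
    rw [hV]
    ext i j
    exact (hmul i j).integral_eq
  simp only [hcov] at hclt
  let B : ℕ → Ω → EuclideanSpace ℝ (Fin k) := fun n ω =>
    WithLp.toLp 2 fun j => SampleMoments.errorFactor S m μ ((j : ℕ) + 1) n ω
  have hB n : AEMeasurable (B n) P := (WithLp.measurable_toLp 2 _).comp_aemeasurable
    (aemeasurable_pi_lambda _ fun j => SampleMoments.aemeasurable_errorFactor hS m μ _ n)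
  have hBlim : TendstoInMeasure P B atTop fun _ => 0 := by
    refine tendstoInMeasure_of_tendsto_ae (fun n => (hB n).aestronglyMeasurable) ?_
    have : ∀ᵐ ω ∂P, ∀ j : Fin k, Tendsto
        (fun n => SampleMoments.errorFactor S m μ ((j : ℕ) + 1) n ω) atTop (nhds 0) :=
      ae_all_iff.2 fun j => SampleMoments.ae_tendsto_errorFactor hX hk hmom hindep hident
        (by omega) (by omega)
    filter_upwards [this] with ω hω
    exact ((PiLp.continuous_toLp 2 _).tendsto 0).comp (tendsto_pi_nhds.2 hω)
  -- The multiplier `√n z` of the error is the first coordinate of the main term, so the whole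
  -- vector is a continuous function of the pair (main term, error factor), equal to the main term
  -- when the factor is `0`.
  have hslutsky := hclt.continuous_comp_prodMk_of_tendstoInMeasure_const
    (g := fun p : EuclideanSpace ℝ (Fin k) × EuclideanSpace ℝ (Fin k) =>
      p.1 + p.1 ⟨0, hk⟩ • p.2) (by fun_prop) hBlim hB
  convert! hslutsky using 1
  · ext n ω j
    rw [SampleMoments.sqrt_smul_sampleVector_sub_apply]
    simp [u, B, SampleMoments.linearTerm, μ]
  · ext ω j
    simp
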